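/- Let $V=\{1,\dots,n\}$ be a set of agents, split into two communities $V_1,V_2$ and also into regular agents $V_r$ and stubborn agents $V_s$. For $k=1,2$ let $n_k$, $n_{rk}\ge 1$, $n_{sk}\ge 1$ be the numbers of all, regular and stubborn agents in $V_k$. Let $q\in[0,1)$, and let $w_s,w_d>0$ with $w_s\ne w_d$ and $(n_1(n_1-1)+n_2(n_2-1))w_s+2n_1n_2w_d=2$. For $i\ne j$ put $w_{ij}=w_s$ if $i,j$ lie in the same community and $w_{ij}=w_d$ otherwise. *Gossip model:* $X(0)\in\mathbb{R}^n$ is deterministic. At each time $t\in\mathbb{N}$ an edge $\{i,j\}$, $i\neq j$, is selected with probability $w_{ij}$, independently over time. Each regular endpoint of the selected edge replaces its state by $q$ times its own state plus $1-q$ times the state of the other endpoint. All other agents keep their states, which gives $X(t+1)$. Assume that $\min_{j\in V_s}X_j(0)\le X_i(0)\le\max_{j\in V_s}X_j(0)$ for all $i\in V_r$. Put $\sigma_k=\sum_{i\in V_k\cap V_s}X_i(0)$ and assume $\sigma_1/n_{s1}\ne\sigma_2/n_{s2}$. Suppose that for every $i\in V_s$ a regular agent $j_i$ of the same community is known. *Algorithm*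 (step-size parameter $a>0$; arbitrary, possibly random, initial values $\hat w_s(0),\hat w_d(0)$): let $S_i(t)=\frac1{t+1}\sum_{u=0}^{t}X_i(u)$ for $i\in V_r$, and let $\bar s(t)$ be the mean of $S_i(t)$ over $i\in V_r$. For $t\ge1$ let $\hat C(i,t)=1$ if $S_i(t)>\bar s(t)$ and $\hat C(i,t)=2$ otherwise for $i\in V_r$, and $\hat C(i,t)=\hat C(j_i,t)$ for $i\in V_s$. Let $\hat n_k$, $\hat V_{rk}$, $\hat V_{sk}$ be the number of agents, the set of regular agents and the set of stubborn agents with estimated label $k$ at time $t$, and let $\hat m=\hat n_1^2+\hat n_2^2-\hat n_1-\hat n_2$. With $$h_1(t)=\tfrac{|\hat V_{s1}|}{|\hat V_{r1}|}\sum_{i\in\hat V_{r1}}S_i(t)-\sum_{i\in\hat V_{s1}}X_i(0),\qquad h_2(t)=\tfrac{\hat n_2}{|\hat V_{r1}|}\sum_{i\in\hat V_{r1}}S_i(t)-\sum_{i\in\hat V_{r2}}S_i(t)-\sum_{i\in\hat V_{s2}}X_i(0),$$ $$g(t)=h_1(t)-\tfrac{\hat m}{2\hat n_1\hat n_2}h_2(t)$$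 (a fraction with denominator zero is read as $0$), put $$\hat w_s(t)=\hat w_s(t-1)-\tfrac at\,\mathrm{sgn}(g(t))\Big(g(t)\hat w_s(t-1)+\tfrac{h_2(t)}{\hat n_1\hat n_2}\Big),\qquad \hat w_d(t)=\frac{2-\hat w_s(t)\,\hat m}{2\hat n_1\hat n_2}.$$ *Constants:* let $$\delta=w_s^2n_{s1}n_{s2}+w_sw_d(n_1n_{s1}+n_2n_{s2})+w_d^2(n_1n_2-n_{r1}n_{r2}),$$ $$\chi_k=\frac{(w_s^2n_{s,3-k}+w_sw_dn_k+w_d^2n_{r,3-k})\sigma_k+w_d(w_sn_{3-k}+w_dn_k)\sigma_{3-k}}{\delta},$$ which is the limit of the expected states of the regular agents of $V_k$, and $$\eta=\frac{(w_sn_2+w_dn_1)(n_{s1}\sigma_2-n_{s2}\sigma_1)}{\delta n_1n_2}.$$ Number the communities so that $\chi_1>\chi_2$ (the assumptions imply $\chi_1\ne\chi_2$). Then, for every $d_0\in[0,\min\{1/2,a|\eta|\})$, $(\hat w_s(t)-w_s,\ \hat w_d(t)-w_d)=o(t^{-d_0})$ as $t\to\infty$, almost surely. -/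

import Mathlib

open MeasureTheory ProbabilityTheory Filter Asymptotics

/-- The two community labels. -/
inductive Label where
  | one
  | two
  deriving DecidableEq

/-- The label different from `k` (written `3 - k` when the labels are `1` and `2`). -/
def Label.other : Label → Label
  | .one => .two
  | .two => .one

/-- The data of a two-community gossip model with stubborn agents on the agent set `Fin n`. -/
structure GossipModel (n : ℕ) where
  /-- the community structure -/
  label : Fin n → Label
  /-- the set of stubborn agents; all other agents are regular -/
  stubborn : Finset (Fin n)
  /-- the averaging weight -/
  q : ℝ
  /-- interaction probability of two distinct agents of the same community -/
  ws : ℝ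
  /-- interaction probability of two agents of different communities -/
  wd : ℝ
  /-- the deterministic initial state vector `X(0)` -/
  x0 : Fin n → ℝ

noncomputable section

namespace GossipModel

variable {n : ℕ} (N : GossipModel n)

/-- Agents of community `k`. -/
def comm (k : Label) : Finset (Fin n) := Finset.univ.filter fun i => N.label i = k

/-- Regular agents of community `k`. -/
def reg (k : Label) : Finset (Fin n) := (N.comm k).filter fun i => i ∉ N.stubborn

/-- Stubborn agents of community `k`. -/
def stub (k : Label) : Finset (Fin n) := (N.comm k).filter fun i => i ∈ N.stubborn

/-- `n_k`, as a real number. -/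
def nC (k : Label) : ℝ := ((N.comm k).card : ℝ)

/-- `n_{rk}`, as a real number. -/
def nR (k : Label) : ℝ := ((N.reg k).card : ℝ)

/-- `n_{sk}`, as a real number. -/
def nS (k : Label) : ℝ := ((N.stub k).card : ℝ)

/-- The sum of the states of the stubborn agents of community `k`. -/
def stubSum (k : Label) : ℝ := ∑ i ∈ N.stub k, N.x0 i

/-- The interaction probability matrix. -/
def W : Matrix (Fin n) (Fin n) ℝ := Matrix.of fun i j =>
  if i = j then 0 else if N.label i = N.label j then N.ws else N.wd

/-- The update matrix `R^{ij}` applied when the edge `{i, j}` is selected. -/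
def R (i j : Fin n) : Matrix (Fin n) (Fin n) ℝ :=
  let e : Fin n → Fin n → ℝ := fun k => Pi.single k 1
  if i ∉ N.stubborn ∧ j ∉ N.stubborn then
    1 - (1 - N.q) • Matrix.vecMulVec (e i - e j) (e i - e j)
  else if i ∉ N.stubborn ∧ j ∈ N.stubborn then
    1 - (1 - N.q) • Matrix.vecMulVec (e i) (e i - e j)
  else if i ∈ N.stubborn ∧ j ∉ N.stubborn then
    1 - (1 - N.q) • Matrix.vecMulVec (e j) (e j - e i)
  else 1

/-- The trajectory `X(t+1) = R(t) X(t)` when `edge t` is the edge selected at time `t`. -/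
def state (edge : ℕ → Fin n × Fin n) : ℕ → Fin n → ℝ
  | 0 => N.x0
  | t + 1 => (N.R (edge t).1 (edge t).2).mulVec (state edge t)

/-- `{edge t}` are i.i.d. and, at each time, the edge `{i, j}` with `i < j` (encoded as the pair
`(i, j)`) is selected with probability `w_{ij}`. -/
structure IsEdgeSelection {Ω : Type*} [MeasurableSpace Ω] (P : Measure Ω)
    (edge : ℕ → Ω → Fin n × Fin n) : Prop where
  measurable : ∀ t, Measurable (edge t)
  indep : iIndepFun edge P
  law : ∀ t i j, i < j → P {ω | edge t ω = (i, j)} = ENNReal.ofReal (N.W i j)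

/-- The standing assumptions on the model: both communities contain regular agents, the interaction
probabilities are positive and distinct and sum to one over all edges, and the initial regular
states lie between the extreme stubborn states. -/
structure CommunityAssumption : Prop where
  reg_nonempty : ∀ k, (N.reg k).Nonempty
  q_nonneg : 0 ≤ N.q
  q_lt_one : N.q < 1
  ws_pos : 0 < N.ws
  wd_pos : 0 < N.wd
  ws_ne_wd : N.ws ≠ N.wd
  total : (N.nC .one * (N.nC .one - 1) + N.nC .two * (N.nC .two - 1)) * N.ws
    + 2 * N.nC .one * N.nC .two * N.wd = 2
  init_mem : ∀ i, i ∉ N.stubborn →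
    N.x0 i ∈ Set.Icc (⨅ j : N.stubborn, N.x0 j) (⨆ j : N.stubborn, N.x0 j)

/-- Both communities contain stubborn agents, and the averages of the stubborn states of the two
communities differ. -/
structure StubbornAssumption : Prop where
  stub_nonempty : ∀ k, (N.stub k).Nonempty
  mean_ne : N.stubSum .one / N.nS .one ≠ N.stubSum .two / N.nS .two

/-- The constant `δ`. -/
def delta : ℝ :=
  N.ws ^ 2 * N.nS .one * N.nS .two
    + N.ws * N.wd * (N.nC .one * N.nS .one + N.nC .two * N.nS .two)
    + N.wd ^ 2 * (N.nC .one * N.nC .two - N.nR .one * N.nR .two)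

/-- `χ_k`, the limit of the expected state of the regular agents of community `k`. -/
def chi (k : Label) : ℝ :=
  ((N.ws ^ 2 * N.nS k.other + N.ws * N.wd * N.nC k + N.wd ^ 2 * N.nR k.other) * N.stubSum k
    + N.wd * (N.ws * N.nC k.other + N.wd * N.nC k) * N.stubSum k.other) / N.delta

/-- The constant `η`, written for the numbering of the communities in which `k` comes first. -/
def eta (k : Label) : ℝ :=
  (N.ws * N.nC k.other + N.wd * N.nC k)
    * (N.nS k * N.stubSum k.other - N.nS k.other * N.stubSum k)
    / (N.delta * N.nC .one * N.nC .two)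

end GossipModel

/-- What the joint recovery and estimation algorithm is given besides the trajectory: the set of
stubborn agents, for every stubborn agent `i` a regular agent `rep i`, the step-size parameter `a`,
and the initial estimates. -/
structure AlgorithmInput (n : ℕ) where
  stubborn : Finset (Fin n)
  rep : Fin n → Fin n
  a : ℝ
  label0 : Fin n → Label
  ws0 : ℝ
  wd0 : ℝ

namespace AlgorithmInput

variable {n : ℕ} (I : AlgorithmInput n) (x : ℕ → Fin n → ℝ)

/-- `S_i(t)`, the running time average of the observed state of agent `i`. -/
def timeAvg : ℕ → Fin n → ℝ
  | 0 => x 0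
  | t + 1 => fun i =>
      ((t + 1 : ℕ) : ℝ) / ((t + 2 : ℕ) : ℝ) * timeAvg t i + 1 / ((t + 2 : ℕ) : ℝ) * x (t + 1) i

/-- The mean of the time averages over all regular agents. -/
def meanAvg (t : ℕ) : ℝ := 1 / (I.stubbornᶜ.card : ℝ) * ∑ i ∈ I.stubbornᶜ, timeAvg x t i

/-- The label assigned at time `t ≥ 1` to a regular agent. -/
def regLabel (t : ℕ) (i : Fin n) : Label :=
  if I.meanAvg x t < timeAvg x t i then .one else .two

/-- Community recovery: the estimated labels. -/
def labelHat : ℕ → Fin n → Label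
  | 0 => I.label0
  | t + 1 => fun i =>
      if i ∈ I.stubborn then I.regLabel x (t + 1) (I.rep i) else I.regLabel x (t + 1) i

/-- The estimated size of community `k`. -/
def nHat (k : Label) (t : ℕ) : ℝ :=
  ((Finset.univ.filter fun i => I.labelHat x t i = k).card : ℝ)

/-- Regular agents with estimated label `k`. -/
def regHat (k : Label) (t : ℕ) : Finset (Fin n) :=
  Finset.univ.filter fun i => i ∉ I.stubborn ∧ I.labelHat x t i = k

/-- Stubborn agents with estimated label `k`. -/
def stubHat (k : Label) (t : ℕ) : Finset (Fin n) :=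
  Finset.univ.filter fun i => i ∈ I.stubborn ∧ I.labelHat x t i = k

def h1 (t : ℕ) : ℝ :=
  ((I.stubHat x .one t).card : ℝ) / ((I.regHat x .one t).card : ℝ)
      * ∑ i ∈ I.regHat x .one t, timeAvg x t i
    - ∑ i ∈ I.stubHat x .one t, x 0 i

def h2 (t : ℕ) : ℝ :=
  I.nHat x .two t / ((I.regHat x .one t).card : ℝ) * ∑ i ∈ I.regHat x .one t, timeAvg x t i
    - ∑ i ∈ I.regHat x .two t, timeAvg x t i
    - ∑ i ∈ I.stubHat x .two t, x 0 i

/-- `n̂₁² + n̂₂² - n̂₁ - n̂₂`. -/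
def sameHat (t : ℕ) : ℝ :=
  I.nHat x .one t ^ 2 + I.nHat x .two t ^ 2 - I.nHat x .one t - I.nHat x .two t

def g (t : ℕ) : ℝ :=
  I.h1 x t - I.sameHat x t / (2 * I.nHat x .one t * I.nHat x .two t) * I.h2 x t

/-- The estimate of `w_s`. -/
def wsHat : ℕ → ℝ
  | 0 => I.ws0
  | t + 1 =>
      wsHat t - I.a / ((t + 1 : ℕ) : ℝ) * Real.sign (I.g x (t + 1))
        * (I.g x (t + 1) * wsHat t
            + I.h2 x (t + 1) / (I.nHat x .one (t + 1) * I.nHat x .two (t + 1)))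

/-- The estimate of `w_d`. -/
def wdHat : ℕ → ℝ
  | 0 => I.wd0
  | t + 1 =>
      (2 - I.wsHat x (t + 1) * I.sameHat x (t + 1))
        / (2 * I.nHat x .one (t + 1) * I.nHat x .two (t + 1))

end AlgorithmInput

end

/-! ### A contracting recursion with vanishing step size -/

/-! The heart of the proof is a rate for the time averages `S_i(t)`. The mean drift of a regular
coordinate is `1 - q` times a weighted graph Laplacian of the state. Summing one-step changes
therefore expresses the Laplacian of `S(t)` through bounded boundary terms and a sum of centred
noise, all divided by `t + 1` (`laplacian_timeAvg`). An Azuma–Hoeffding bound and Borel–Cantelli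
give `O(t ^ (1/2 + ε))` for the noise sum (`ae_eventually_abs_sum_increments_le`). The limiting
profile (stubborn values, and `χ_k` on regular agents) is harmonic at regular agents, so the maximum
principle gives `S(t) - profile = O(t ^ (-d))` almost surely for each `d < 1/2`
(`ae_isBigO_timeAvg_sub_profile`). No ergodicity of the gossip chain is needed.

The limit of `s̄(t)` lies strictly between the two values `χ`, so all labels are eventually correct
(`eventually_labelHat_eq`). From then on `h₁`, `h₂` and `g` are affine in the deviations of the time
averages, with `g → η` and `h₂ → -w_s η n₁ n₂`. Hence `w_s` is the root of the limiting update, and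
the error of `ŵ_s` follows `e(t+1) = (1 - a|g|/(t+1)) e(t) + O(t ^ (-d))/(t+1)`. Such a recursion
keeps the rate `t ^ (-d)` when `d < a|η|` (`isBigO_rpow_neg_of_recursion`). The error of `ŵ_d` is
eventually a fixed multiple of that of `ŵ_s`. -/

/-- Passing from `t ^ (-d)` to `(t+1) ^ (-d)` costs a factor of at most `1 + d/t`, while the
contraction gains about `1 - c'/t`. Half of the gap `c' - d` pays for the forcing `C`, the other
half for the lower-order term `d`, once `t` is large. -/
theorem rpow_neg_contraction_step {d c' C K : ℝ} (hd0 : 0 ≤ d) (hd1 : d ≤ 1) (hK : 0 < K)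
    (hCK : C / K ≤ (c' - d) / 2) (hc0 : 0 ≤ c') {t : ℕ} (ht0 : 0 < t)
    (ht : 2 * d ≤ t * (c' - d)) (htc : c' ≤ t + 1) :
    (1 - c' / (t + 1)) * (K * (t : ℝ) ^ (-d)) + C * ((t + 1 : ℕ) : ℝ) ^ (-d) / (t + 1)
      ≤ K * ((t + 1 : ℕ) : ℝ) ^ (-d) := by
  have htp : (0 : ℝ) < t := by exact_mod_cast ht0
  have hu : (0 : ℝ) < ((t + 1 : ℕ) : ℝ) ^ (-d) := Real.rpow_pos_of_pos (by positivity) _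
  have hbern : (t : ℝ) ^ (-d) ≤ (1 + d / t) * ((t + 1 : ℕ) : ℝ) ^ (-d) := by
    -- Bernoulli for exponents in `[0, 1]`; this is where `d ≤ 1` enters.
    have h1 : (1 + 1 / (t : ℝ)) ^ d ≤ 1 + d * (1 / t) :=
      rpow_one_add_le_one_add_mul_self ((neg_nonpos.2 zero_le_one).trans (by positivity)) hd0 hd1
    have h2 : (1 + 1 / (t : ℝ)) ^ d = ((t + 1 : ℕ) : ℝ) ^ d / (t : ℝ) ^ d := by
      rw [← Real.div_rpow (by positivity) htp.le]
      congr 1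
      push_cast
      field_simp
    rw [Real.rpow_neg htp.le, Real.rpow_neg (by positivity)]
    rw [h2] at h1
    have h3 : 0 < ((t + 1 : ℕ) : ℝ) ^ d := Real.rpow_pos_of_pos (by positivity) _
    have h4 : 0 < (t : ℝ) ^ d := Real.rpow_pos_of_pos htp _
    rw [← div_eq_mul_inv, le_div_iff₀ h3, ← div_eq_inv_mul]
    calc _ ≤ 1 + d * (1 / t) := h1
      _ = _ := by ring
  set u := ((t + 1 : ℕ) : ℝ) ^ (-d)
  have hnn : 0 ≤ 1 - c' / ((t : ℝ) + 1) := by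
    rw [sub_nonneg, div_le_one (by positivity)]
    exact htc
  have key : (1 - c' / ((t : ℝ) + 1)) * (1 + d / t) + C / K / (t + 1) ≤ 1 := by
    have : (1 - c' / ((t : ℝ) + 1)) * (1 + d / t) + C / K / (t + 1)
        = ((t + 1 - c') * (t + d) + C / K * t) / (t * (t + 1)) := by field_simp
    rw [this, div_le_one (by positivity)]
    nlinarith [mul_nonneg hd0 hc0, mul_le_mul_of_nonneg_right hCK htp.le]
  calc _ ≤ (1 - c' / ((t : ℝ) + 1)) * (K * ((1 + d / t) * u)) + C * u / (t + 1) := by gcongr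
    _ = K * u * ((1 - c' / ((t : ℝ) + 1)) * (1 + d / t) + C / K / (t + 1)) := by field_simp
    _ ≤ K * u * 1 := by gcongr
    _ = _ := by ring

/-- By the one-step estimate, `K * t ^ (-d)` is a supersolution for any rate `c'` strictly between
`d` and `c₀`, so it dominates `|e t|` by induction. -/
theorem isBigO_rpow_neg_of_recursion {e c r : ℕ → ℝ} {c₀ d : ℝ} (hd0 : 0 ≤ d) (hd1 : d ≤ 1)
    (hdc : d < c₀) (hc : Tendsto c atTop (nhds c₀))
    (hr : r =O[atTop] fun t : ℕ => (t : ℝ) ^ (-d))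
    (he : ∀ t : ℕ, e (t + 1) = (1 - c (t + 1) / (t + 1)) * e t + r (t + 1) / (t + 1)) :
    e =O[atTop] fun t : ℕ => (t : ℝ) ^ (-d) := by
  obtain ⟨c', hdc', hc'⟩ := exists_between hdc
  have hc0 : 0 ≤ c' := hd0.trans hdc'.le
  obtain ⟨C, hCpos, hC⟩ := hr.exists_pos
  rw [IsBigOWith] at hC
  have h1 : ∀ᶠ t : ℕ in atTop, c' ≤ c t := hc.eventually_const_le hc'
  have h2 : ∀ᶠ t : ℕ in atTop, c t ≤ c₀ + 1 :=
    hc.eventually_le_const (lt_add_one c₀)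
  have h3 : ∀ᶠ t : ℕ in atTop, c₀ + 1 ≤ (t : ℝ) := tendsto_natCast_atTop_atTop.eventually_ge_atTop _
  have h4 : ∀ᶠ t : ℕ in atTop, 2 * d / (c' - d) ≤ (t : ℝ) :=
    tendsto_natCast_atTop_atTop.eventually_ge_atTop _
  obtain ⟨t₀, ht₀⟩ := eventually_atTop.1 (h1.and (h2.and (h3.and (h4.and (hC.and
    (eventually_gt_atTop 0))))))
  have hpos : ∀ t : ℕ, t₀ ≤ t → 0 < (t : ℝ) ^ (-d) := fun t ht =>
    Real.rpow_pos_of_pos (by exact_mod_cast (ht₀ t ht).2.2.2.2.2) _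
  have hcd : 0 < c' - d := sub_pos.2 hdc'
  -- The first entry absorbs the forcing, the second starts the induction at `t₀`.
  set K := max (2 * C / (c' - d)) (|e t₀| / (t₀ : ℝ) ^ (-d))
  have hK : 0 < K := lt_of_lt_of_le (by positivity) (le_max_left _ _)
  have hCK : C / K ≤ (c' - d) / 2 := by
    have h : 2 * C / (c' - d) ≤ K := le_max_left _ _
    rw [div_le_iff₀ hcd] at h
    rw [div_le_iff₀ hK]
    linarith
  refine IsBigO.of_bound K (eventually_atTop.2 ⟨t₀, fun t ht => ?_⟩)
  rw [Real.norm_eq_abs, Real.norm_of_nonneg (hpos t ht).le]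
  induction t, ht using Nat.le_induction with
  | base => rw [← div_le_iff₀ (hpos t₀ le_rfl)]; exact le_max_right _ _
  | succ t ht ih =>
    obtain ⟨-, -, g3, g4, -, g5⟩ := ht₀ t ht
    obtain ⟨f1, f2, -, -, f5, -⟩ := ht₀ (t + 1) (by omega)
    rw [Real.norm_eq_abs, Real.norm_of_nonneg (hpos (t + 1) (by omega)).le] at f5
    have htp : (0 : ℝ) < t := by exact_mod_cast g5
    have hn : 0 ≤ 1 - c (t + 1) / ((t : ℝ) + 1) := by
      rw [sub_nonneg, div_le_one (by positivity)]
      linarith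
    refine le_trans ?_ (rpow_neg_contraction_step hd0 hd1 hK hCK hc0 g5 ?_ ?_)
    · rw [he t]
      refine (abs_add_le _ _).trans ?_
      rw [abs_mul, abs_div, abs_of_nonneg hn, abs_of_pos (by positivity : (0 : ℝ) < t + 1)]
      gcongr
      exact hn.trans (by gcongr)
    · rwa [div_le_iff₀ hcd] at g4
    · linarith

/-! ### Concentration of additive functionals of an independent sequence -/

section Concentration

variable {Ω α : Type*} [MeasurableSpace Ω] {P : Measure Ω} [IsProbabilityMeasure P]
  [Fintype α] [MeasurableSpace α] [MeasurableSingletonClass α] {X : ℕ → Ω → α}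

theorem measurable_comp_history (hm : ∀ t, Measurable (X t)) (T : ℕ) {Φ : (ℕ → α) → ℝ}
    (hΦ : ∀ s s', (∀ i < T, s i = s' i) → Φ s = Φ s') :
    Measurable fun ω => Φ fun i => X i ω := by
  classical
  rcases isEmpty_or_nonempty α with hα | ⟨⟨e⟩⟩
  · have : IsEmpty Ω := ⟨fun ω => hα.elim (X 0 ω)⟩
    exact Measurable.of_discrete
  have : (fun ω => Φ fun i => X i ω)
      = (fun h : (i : Finset.range T) → α =>
          Φ fun i => if hi : i ∈ Finset.range T then h ⟨i, hi⟩ else e) ∘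
        fun ω (i : Finset.range T) => X i ω := by
    funext ω
    refine hΦ _ _ fun i hi => ?_
    simp [hi]
  rw [this]
  exact (measurable_of_finite _).comp (measurable_pi_lambda _ fun i => hm i)

/-- This plays the role of conditioning on the past: split over the values of `X T`, whose
indicators are independent of the first `T` draws. -/
theorem integral_comp_history_of_bound (hm : ∀ t, Measurable (X t)) (hi : iIndepFun X P)
    (T : ℕ) {Φ : (ℕ → α) → α → ℝ}
    (hΦ : ∀ s s' e, (∀ i < T, s i = s' i) → Φ s e = Φ s' e) {B : ℝ} (hB : ∀ s e, |Φ s e| ≤ B) :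
    ∫ ω, Φ (fun i => X i ω) (X T ω) ∂P
      = ∫ ω, ∑ e, P.real {ω | X T ω = e} * Φ (fun i => X i ω) e ∂P := by
  classical
  have hmΦ : ∀ e, Measurable fun ω => Φ (fun i => X i ω) e := fun e =>
    measurable_comp_history hm T fun s s' h => hΦ s s' e h
  have hint : ∀ e, Integrable (fun ω => Φ (fun i => X i ω) e) P := fun e =>
    Integrable.of_bound (hmΦ e).aestronglyMeasurable B (ae_of_all _ fun ω => hB _ _)
  have hms : ∀ e, MeasurableSet {ω | X T ω = e} := fun e => hm T (measurableSet_singleton e)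
  have hsplit : ∀ ω, Φ (fun i => X i ω) (X T ω)
      = ∑ e, Φ (fun i => X i ω) e * Set.indicator {ω | X T ω = e} 1 ω := by
    intro ω
    rw [Finset.sum_eq_single (X T ω)]
    · simp
    · intro e _ he
      simp [Ne.symm he]
    · simp
  simp_rw [hsplit]
  rw [integral_finsetSum, integral_finsetSum]
  · refine Finset.sum_congr rfl fun e _ => ?_
    have hind : IndepFun (fun ω => Φ (fun i => X i ω) e)
        (Set.indicator {ω | X T ω = e} (1 : Ω → ℝ)) P := by
      have h := hi.indepFun_finset (Finset.range T) {T} (by simp) hm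
      have h' := h.comp (φ := fun h : (i : Finset.range T) → α =>
          Φ (fun i => if hi : i ∈ Finset.range T then h ⟨i, hi⟩ else e) e)
        (ψ := fun h : (i : ({T} : Finset ℕ)) → α =>
          if h ⟨T, by simp⟩ = e then (1 : ℝ) else 0)
        (measurable_of_finite _) (measurable_of_finite _)
      convert h' using 1
      · funext ω
        refine hΦ _ _ _ fun i hi => ?_
        simp [hi]
      · funext ω
        simp [Set.indicator_apply]
    rw [hind.integral_fun_mul_eq_mul_integral (hmΦ e).aestronglyMeasurable
      ((measurable_one.indicator (hms e)).aestronglyMeasurable),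
      integral_indicator_one (hms e), integral_const_mul, mul_comm]
  · exact fun e _ => (hint e).const_mul _
  · intro e _
    refine Integrable.of_bound ((hmΦ e).mul (measurable_one.indicator (hms e))).aestronglyMeasurable
      B (ae_of_all _ fun ω => ?_)
    rw [norm_mul]
    calc _ ≤ B * 1 := by
          gcongr
          · exact (abs_nonneg _).trans (hB (fun i => X i ω) e)
          · exact hB _ _
          · by_cases h : X T ω = e <;> simp [h]
      _ = B := mul_one B

/-- By convexity the exponential lies below its chord over `[-c, c]`. -/
theorem exp_le_cosh_add_sinh {c y l : ℝ} (hc : 0 < c) (hy : |y| ≤ c) :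
    Real.exp (l * y) ≤ Real.cosh (l * c) + y / c * Real.sinh (l * c) := by
  obtain ⟨h1, h2⟩ := abs_le.1 hy
  have ha : 0 ≤ (1 + y / c) / 2 := by
    have : -1 ≤ y / c := by rw [le_div_iff₀ hc]; linarith
    linarith
  have hb : 0 ≤ (1 - y / c) / 2 := by
    have : y / c ≤ 1 := by rw [div_le_iff₀ hc]; linarith
    linarith
  have h := convexOn_exp.2 (Set.mem_univ (l * c)) (Set.mem_univ (-(l * c))) ha hb (by ring)
  simp only [smul_eq_mul] at h
  have h3 : (1 + y / c) / 2 * (l * c) + (1 - y / c) / 2 * -(l * c) = l * y := by field_simp; ring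
  rw [h3] at h
  refine h.trans (le_of_eq ?_)
  rw [Real.cosh_eq, Real.sinh_eq]
  ring

omit [MeasurableSpace α] [MeasurableSingletonClass α] in
-- Hoeffding's lemma: centring kills the linear part of the chord, leaving `cosh (l * c)`.
theorem sum_mul_exp_le {p y : α → ℝ} (hp : ∀ e, 0 ≤ p e) (hp1 : ∑ e, p e = 1)
    (hy : ∑ e, p e * y e = 0) {c : ℝ} (hc : 0 < c) (hyc : ∀ e, |y e| ≤ c) (l : ℝ) :
    ∑ e, p e * Real.exp (l * y e) ≤ Real.exp ((l * c) ^ 2 / 2) := by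
  calc ∑ e, p e * Real.exp (l * y e)
      ≤ ∑ e, p e * (Real.cosh (l * c) + y e / c * Real.sinh (l * c)) := by
        gcongr with e _
        · exact hp e
        · exact exp_le_cosh_add_sinh hc (hyc e)
    _ = Real.cosh (l * c) * ∑ e, p e + (∑ e, p e * y e) * (Real.sinh (l * c) / c) := by
        rw [Finset.mul_sum, Finset.sum_mul, ← Finset.sum_add_distrib]
        refine Finset.sum_congr rfl fun e _ => ?_
        ring
    _ ≤ _ := by
        rw [hp1, hy, zero_mul, mul_one, add_zero]
        exact Real.cosh_le_exp_half_sq _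

variable (hm : ∀ t, Measurable (X t)) (hi : iIndepFun X P) {p : α → ℝ}
  (hp : ∀ t e, P.real {ω | X t ω = e} = p e) {D : ℕ → (ℕ → α) → α → ℝ}
  (hD : ∀ t s s' e, (∀ i < t, s i = s' i) → D t s e = D t s' e)
  (hD0 : ∀ t s, ∑ e, p e * D t s e = 0) {c : ℝ} (hc : 0 < c) (hDc : ∀ t s e, |D t s e| ≤ c)

include hm hp in
theorem sum_law_eq_one : ∑ e, p e = 1 := by
  have h := sum_measureReal_preimage_singleton (μ := P) (Finset.univ : Finset α) (f := X 0)
    fun e _ => hm 0 (measurableSet_singleton e)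
  simp only [Finset.coe_univ, Set.preimage_univ, probReal_univ] at h
  rw [← h]
  exact Finset.sum_congr rfl fun e _ => (hp 0 e).symm

omit [Fintype α] [MeasurableSpace α] [MeasurableSingletonClass α] in
include hD in
theorem sum_increments_congr (T : ℕ) (s s' : ℕ → α) (h : ∀ i < T, s i = s' i) :
    ∑ t ∈ Finset.range T, D t s (s t) = ∑ t ∈ Finset.range T, D t s' (s' t) := by
  refine Finset.sum_congr rfl fun t ht => ?_
  have ht' := Finset.mem_range.1 ht
  rw [h t ht', hD t s s' _ fun i hi => h i (hi.trans ht')]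

omit [Fintype α] [MeasurableSpace α] [MeasurableSingletonClass α] in
include hDc in
theorem abs_sum_increments_le (T : ℕ) (s : ℕ → α) :
    |∑ t ∈ Finset.range T, D t s (s t)| ≤ T * c := by
  refine (Finset.abs_sum_le_sum_abs _ _).trans ?_
  refine (Finset.sum_le_sum fun t _ => hDc t s (s t)).trans ?_
  simp

omit [Fintype α] [MeasurableSpace α] [MeasurableSingletonClass α] in
include hDc in
theorem exp_mul_sum_increments_le (l : ℝ) (T : ℕ) (s : ℕ → α) :
    Real.exp (l * ∑ t ∈ Finset.range T, D t s (s t)) ≤ Real.exp (|l| * (T * c)) := by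
  refine Real.exp_le_exp.2 ((le_abs_self _).trans ?_)
  rw [abs_mul]
  gcongr
  exact abs_sum_increments_le hDc T s

include hm hD hDc in
theorem integrable_exp_mul_sum_increments (l : ℝ) (T : ℕ) :
    Integrable (fun ω => Real.exp
      (l * ∑ t ∈ Finset.range T, D t (fun i => X i ω) (X t ω))) P := by
  refine Integrable.of_bound (C := Real.exp (|l| * (T * c))) ?_ (ae_of_all _ fun ω => ?_)
  · refine Measurable.aestronglyMeasurable ?_
    exact measurable_comp_history (Φ := fun s =>
      Real.exp (l * ∑ t ∈ Finset.range T, D t s (s t))) hm T fun s s' h => by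
        rw [sum_increments_congr hD T s s' h]
  · rw [Real.norm_of_nonneg (Real.exp_pos _).le]
    exact exp_mul_sum_increments_le hDc l T fun i => X i ω

include hm hi hp hD hD0 hc hDc in
-- Azuma–Hoeffding. Since `D T` sees only the draws before `T` and the current one, the last
-- increment can be averaged out with the past frozen, at the cost of one Hoeffding factor.
theorem mgf_sum_increments_le (l : ℝ) (T : ℕ) :
    mgf (fun ω => ∑ t ∈ Finset.range T, D t (fun i => X i ω) (X t ω)) P l
      ≤ Real.exp (T * ((l * c) ^ 2 / 2)) := by
  have hp0 : ∀ e, 0 ≤ p e := fun e => hp 0 e ▸ measureReal_nonneg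
  have hp1 := sum_law_eq_one hm hp
  induction T with
  | zero => simp [mgf]
  | succ T ih =>
    unfold mgf at ih ⊢
    have h := integral_comp_history_of_bound (P := P) hm hi T (Φ := fun s e =>
        Real.exp (l * ∑ t ∈ Finset.range T, D t s (s t)) * Real.exp (l * D T s e))
      (fun s s' e h => by rw [sum_increments_congr hD T s s' h, hD T s s' e h])
      (B := Real.exp (|l| * (T * c)) * Real.exp (|l| * c)) (fun s e => by
        rw [abs_mul, Real.abs_exp, Real.abs_exp]
        refine mul_le_mul (exp_mul_sum_increments_le hDc l T s) (Real.exp_le_exp.2 ?_)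
          (Real.exp_pos _).le (Real.exp_pos _).le
        refine (le_abs_self _).trans ?_
        rw [abs_mul]
        exact mul_le_mul_of_nonneg_left (hDc T s e) (abs_nonneg l))
    calc _ = ∫ ω, ∑ e, P.real {ω | X T ω = e} *
            (Real.exp (l * ∑ t ∈ Finset.range T, D t (fun i => X i ω) (X t ω))
              * Real.exp (l * D T (fun i => X i ω) e)) ∂P := by
          rw [← h]
          refine integral_congr_ae (ae_of_all _ fun ω => ?_)
          simp only [Finset.sum_range_succ, mul_add, Real.exp_add]
      _ ≤ ∫ ω, Real.exp (l * ∑ t ∈ Finset.range T, D t (fun i => X i ω) (X t ω))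
            * Real.exp ((l * c) ^ 2 / 2) ∂P := by
          refine integral_mono_of_nonneg (ae_of_all _ fun ω => ?_)
            ((integrable_exp_mul_sum_increments hm hD hDc l T).mul_const _)
            (ae_of_all _ fun ω => ?_)
          · exact Finset.sum_nonneg fun e _ => mul_nonneg measureReal_nonneg (by positivity)
          · calc _ = Real.exp (l * ∑ t ∈ Finset.range T, D t (fun i => X i ω) (X t ω))
                  * ∑ e, p e * Real.exp (l * D T (fun i => X i ω) e) := by
                  rw [Finset.mul_sum]
                  refine Finset.sum_congr rfl fun e _ => ?_
                  rw [hp T e]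
                  ring
              _ ≤ _ := by
                  exact mul_le_mul_of_nonneg_left
                    (sum_mul_exp_le hp0 hp1 (hD0 T _) hc (hDc T _) l) (Real.exp_pos _).le
      _ ≤ Real.exp (T * ((l * c) ^ 2 / 2)) * Real.exp ((l * c) ^ 2 / 2) := by
          rw [integral_mul_const]
          exact mul_le_mul_of_nonneg_right ih (Real.exp_pos _).le
      _ = _ := by
          rw [← Real.exp_add]
          congr 1
          push_cast
          ring

theorem summable_exp_neg_rpow {ε : ℝ} (hε : 0 < ε) :
    Summable fun T : ℕ => Real.exp (-(T : ℝ) ^ ε) := by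
  have h : (fun T : ℕ => Real.exp (-(T : ℝ) ^ ε)) =O[atTop] fun T : ℕ => (T : ℝ) ^ (-2 : ℝ) := by
    have h1 := (isLittleO_exp_neg_mul_rpow_atTop one_pos (-2 / ε)).comp_tendsto
      ((tendsto_rpow_atTop hε).comp tendsto_natCast_atTop_atTop)
    refine (h1.isBigO.congr_left fun T => ?_).congr_right fun T => ?_
    · simp
    · simp only [Function.comp]
      rw [← Real.rpow_mul (Nat.cast_nonneg T)]
      congr 1
      field_simp
  exact summable_of_isBigO_nat (Real.summable_nat_rpow.2 (by norm_num)) h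

include hm hi hp hD hD0 hc hDc in
theorem ae_eventually_sum_increments_lt {ε : ℝ} (hε : 0 < ε) :
    ∀ᵐ ω ∂P, ∀ᶠ T : ℕ in atTop,
      ∑ t ∈ Finset.range T, D t (fun i => X i ω) (X t ω) < (T : ℝ) ^ (1 / 2 + ε) := by
  set M : ℕ → Ω → ℝ := fun T ω => ∑ t ∈ Finset.range T, D t (fun i => X i ω) (X t ω)
  set b : ℕ → ℝ := fun T => Real.exp (c ^ 2 / 2) * Real.exp (-(T : ℝ) ^ ε)
  have hb : Summable b := (summable_exp_neg_rpow hε).mul_left _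
  have hle : ∀ T : ℕ, 0 < T → P.real {ω | (T : ℝ) ^ (1 / 2 + ε) ≤ M T ω} ≤ b T := by
    intro T hT
    have hTp : (0 : ℝ) < T := by exact_mod_cast hT
    -- With this Chernoff parameter `T * l ^ 2 = 1`, so the mgf stays below `exp (c ^ 2 / 2)` and
    -- the threshold contributes the summable `exp (-T ^ ε)`.
    set l := (T : ℝ) ^ (-(1 / 2) : ℝ)
    have hl : 0 ≤ l := (Real.rpow_pos_of_pos hTp _).le
    refine (measure_ge_le_exp_mul_mgf _ hl
      (integrable_exp_mul_sum_increments hm hD hDc l T)).trans ?_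
    refine (mul_le_mul_of_nonneg_left (mgf_sum_increments_le hm hi hp hD hD0 hc hDc l T)
      (Real.exp_pos _).le).trans (le_of_eq ?_)
    simp only [b]
    rw [mul_comm]
    have h1 : l * (T : ℝ) ^ (1 / 2 + ε) = (T : ℝ) ^ ε := by
      rw [← Real.rpow_add hTp]
      congr 1
      ring
    have h2 : (T : ℝ) * l ^ 2 = 1 := by
      rw [← Real.rpow_natCast, ← Real.rpow_mul hTp.le]
      norm_num
      rw [Real.rpow_neg hTp.le, Real.rpow_one, mul_inv_cancel₀ hTp.ne']
    congr 2
    · rw [mul_pow]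
      linear_combination c ^ 2 / 2 * h2
    · rw [neg_mul, h1]
  have hsum : ∑' T : ℕ, P {ω | 0 < T ∧ (T : ℝ) ^ (1 / 2 + ε) ≤ M T ω} ≠ ⊤ := by
    refine ne_top_of_le_ne_top hb.tsum_ofReal_ne_top (ENNReal.tsum_le_tsum fun T => ?_)
    rcases Nat.eq_zero_or_pos T with rfl | hT
    · simp
    · rw [← ofReal_measureReal]
      simp only [hT, true_and]
      exact ENNReal.ofReal_le_ofReal (hle T hT)
  filter_upwards [ae_eventually_notMem hsum] with ω hω
  filter_upwards [hω, eventually_gt_atTop 0] with T hT hT0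
  by_contra hcon
  exact hT ⟨hT0, not_lt.1 hcon⟩

include hm hi hp hD hD0 hc hDc in
/-- A sum of bounded increments that are centred given the past grows slower than any power of
exponent greater than `1 / 2`. -/
theorem ae_eventually_abs_sum_increments_le {ε : ℝ} (hε : 0 < ε) :
    ∀ᵐ ω ∂P, ∀ᶠ T : ℕ in atTop,
      |∑ t ∈ Finset.range T, D t (fun i => X i ω) (X t ω)| ≤ (T : ℝ) ^ (1 / 2 + ε) := by
  have h := ae_eventually_sum_increments_lt hm hi hp (D := fun t s e => -D t s e)
    (fun t s s' e h => by rw [hD t s s' e h]) (fun t s => by simp [hD0]) hc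
    (fun t s e => by rw [abs_neg]; exact hDc t s e) hε
  filter_upwards [h, ae_eventually_sum_increments_lt hm hi hp hD hD0 hc hDc hε] with ω h1 h2
  filter_upwards [h1, h2] with T h1 h2
  rw [Finset.sum_neg_distrib] at h1
  exact abs_le.2 ⟨by linarith, h2.le⟩

end Concentration

/-! ### Exchange of the two labels. -/

namespace Label

theorem other_ne (k : Label) : k.other ≠ k := by cases k <;> simp [other]

theorem other_other (k : Label) : k.other.other = k := by cases k <;> rfl

theorem ne_iff_eq_other {j k : Label} : j ≠ k ↔ j = k.other := by
  cases j <;> cases k <;> simp [other]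

end Label

namespace GossipModel

variable {n : ℕ} (N : GossipModel n)

/-! ### One gossip step -/

/-- One formula for all four cases: each endpoint contributes its own displacement, and only if it
is regular. -/
theorem R_mulVec_apply (i j : Fin n) (z : Fin n → ℝ) (l : Fin n) :
    (N.R i j).mulVec z l = z l - (1 - N.q) *
      ((if l = i ∧ i ∉ N.stubborn then z i - z j else 0)
        + if l = j ∧ j ∉ N.stubborn then z j - z i else 0) := by
  by_cases hi : i ∈ N.stubborn <;> by_cases hj : j ∈ N.stubborn <;>
    by_cases h1 : l = i <;> by_cases h2 : l = j <;>
    simp [R, hi, hj, h1, h2, Matrix.sub_mulVec, Matrix.smul_mulVec, Matrix.vecMulVec_mulVec,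
      sub_dotProduct, Pi.single_apply] <;> grind

theorem R_mulVec_symm (i j : Fin n) (z : Fin n → ℝ) : (N.R i j).mulVec z = (N.R j i).mulVec z := by
  funext l
  rw [R_mulVec_apply, R_mulVec_apply]
  ring

theorem abs_R_mulVec_le (hq0 : 0 ≤ N.q) (hq1 : N.q < 1) (i j : Fin n) {z : Fin n → ℝ} {B : ℝ}
    (hz : ∀ l, |z l| ≤ B) (l : Fin n) : |(N.R i j).mulVec z l| ≤ B := by
  rw [R_mulVec_apply]
  have hconv : ∀ x y : ℝ, |x| ≤ B → |y| ≤ B → |x - (1 - N.q) * (x - y)| ≤ B := by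
    intro x y hx hy
    rw [abs_le] at hx hy ⊢
    constructor <;> nlinarith
  have hi := hz i
  have hj := hz j
  by_cases h1 : l = i ∧ i ∉ N.stubborn <;> by_cases h2 : l = j ∧ j ∉ N.stubborn
  -- Here `i = l = j`, and the two displacements cancel.
  · rw [if_pos h1, if_pos h2]
    simpa using hz l
  · rw [if_pos h1, if_neg h2, add_zero, h1.1]
    exact hconv _ _ hi hj
  · rw [if_neg h1, if_pos h2, zero_add, h2.1]
    exact hconv _ _ hj hi
  · rw [if_neg h1, if_neg h2]
    simpa using hz l

theorem state_congr {s s' : ℕ → Fin n × Fin n} {t : ℕ} (h : ∀ i < t, s i = s' i) :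
    N.state s t = N.state s' t := by
  induction t with
  | zero => rfl
  | succ t ih => simp only [state]; rw [ih fun i hi => h i (by omega), h t (by omega)]

theorem state_of_mem_stubborn (s : ℕ → Fin n × Fin n) (t : ℕ) {l : Fin n} (hl : l ∈ N.stubborn) :
    N.state s t l = N.x0 l := by
  induction t with
  | zero => rfl
  | succ t ih =>
    rw [state, R_mulVec_apply, if_neg (by rintro ⟨rfl, h⟩; exact h hl),
      if_neg (by rintro ⟨rfl, h⟩; exact h hl), ih]
    ring

theorem abs_state_le (hq0 : 0 ≤ N.q) (hq1 : N.q < 1) (s : ℕ → Fin n × Fin n) (t : ℕ) (l : Fin n) :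
    |N.state s t l| ≤ ∑ i, |N.x0 i| := by
  induction t generalizing l with
  | zero => exact Finset.single_le_sum (f := fun i => |N.x0 i|) (fun i _ => abs_nonneg _)
              (Finset.mem_univ l)
  | succ t ih => exact N.abs_R_mulVec_le hq0 hq1 _ _ ih l

/-! ### Sums over communities -/

theorem sum_comm_eq (k : Label) (f : Fin n → ℝ) :
    ∑ i ∈ N.comm k, f i = ∑ i ∈ N.stub k, f i + ∑ i ∈ N.reg k, f i :=
  (Finset.sum_filter_add_sum_filter_not (N.comm k) (fun i => i ∈ N.stubborn) f).symm

theorem nC_eq (k : Label) : N.nC k = N.nS k + N.nR k := by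
  have h := N.sum_comm_eq k fun _ => 1
  simpa [nC, nS, nR] using h

theorem sum_univ_eq (k : Label) (f : Fin n → ℝ) :
    ∑ i, f i = ∑ i ∈ N.comm k, f i + ∑ i ∈ N.comm k.other, f i := by
  rw [← Finset.sum_filter_add_sum_filter_not Finset.univ (fun i => N.label i = k) f]
  congr 1
  refine Finset.sum_congr ?_ fun _ _ => rfl
  ext i
  simp [comm, Label.ne_iff_eq_other]

theorem W_symm (i j : Fin n) : N.W i j = N.W j i := by simp [W, eq_comm]

theorem W_self (i : Fin n) : N.W i i = 0 := by simp [W]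

theorem sum_W_mul (l : Fin n) (f : Fin n → ℝ) :
    ∑ j, N.W l j * f j = N.ws * ∑ j ∈ N.comm (N.label l), f j
      + N.wd * ∑ j ∈ N.comm (N.label l).other, f j - N.ws * f l := by
  have h : ∀ j, N.W l j * f j = (if N.label l = N.label j then N.ws else N.wd) * f j
      - if l = j then N.ws * f j else 0 := by
    intro j
    by_cases h : l = j
    · subst h; simp [W]
    · simp [W, h]
  simp_rw [h]
  rw [Finset.sum_sub_distrib, Finset.sum_ite_eq, if_pos (Finset.mem_univ l),
    N.sum_univ_eq (N.label l), Finset.mul_sum, Finset.mul_sum]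
  congr 2
  · refine Finset.sum_congr rfl fun j hj => ?_
    rw [if_pos]
    simpa [comm, eq_comm] using hj
  · refine Finset.sum_congr rfl fun j hj => ?_
    rw [if_neg]
    have hj' : N.label j = (N.label l).other := by simpa [comm] using hj
    rw [hj']
    exact (Label.other_ne _).symm

theorem total_of_label {N : GossipModel n} (hcomm : N.CommunityAssumption) (k : Label) :
    (N.nC k * (N.nC k - 1) + N.nC k.other * (N.nC k.other - 1)) * N.ws
      + 2 * N.nC k * N.nC k.other * N.wd = 2 := by
  have h := hcomm.total
  cases k <;> simp only [Label.other]
  · exact h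
  · linarith

theorem sum_sum_W {N : GossipModel n} (hcomm : N.CommunityAssumption) :
    ∑ i, ∑ j, N.W i j = 2 := by
  have hrow : ∀ i, ∑ j, N.W i j
      = N.ws * N.nC (N.label i) + N.wd * N.nC (N.label i).other - N.ws := by
    intro i
    simpa [nC] using N.sum_W_mul i fun _ => 1
  have hcomm_sum : ∀ k, ∑ i ∈ N.comm k, ∑ j, N.W i j
      = N.nC k * (N.ws * N.nC k + N.wd * N.nC k.other - N.ws) := by
    intro k
    rw [Finset.sum_congr rfl (g := fun _ => N.ws * N.nC k + N.wd * N.nC k.other - N.ws)]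
    · rw [Finset.sum_const, nsmul_eq_mul, nC]
    · intro i hi
      have hi' : N.label i = k := by simpa [comm] using hi
      rw [hrow, hi']
  rw [N.sum_univ_eq .one, hcomm_sum, hcomm_sum]
  have := hcomm.total
  simp only [Label.other]
  linarith

theorem sum_pairs_lt_eq_half {f : Fin n → Fin n → ℝ} (hsymm : ∀ i j, f i j = f j i)
    (hdiag : ∀ i, f i i = 0) :
    ∑ e : Fin n × Fin n, (if e.1 < e.2 then f e.1 e.2 else 0) = (∑ i, ∑ j, f i j) / 2 := by
  rw [Fintype.sum_prod_type]
  have h : ∀ i j, f i j = (if i < j then f i j else 0) + if j < i then f j i else 0 := by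
    intro i j
    rcases lt_trichotomy i j with h | h | h
    · simp [h, h.not_gt]
    · subst h; simp [hdiag]
    · simp [h, h.not_gt, hsymm i j]
  have h2 : ∑ i, ∑ j, f i j = ∑ i, ∑ j, (if i < j then f i j else 0)
      + ∑ i, ∑ j, if j < i then f j i else 0 := by
    simp_rw [← Finset.sum_add_distrib]
    exact Finset.sum_congr rfl fun i _ => Finset.sum_congr rfl fun j _ => h i j
  have h3 : ∑ i, ∑ j, (if j < i then f j i else 0) = ∑ i, ∑ j, if i < j then f i j else 0 :=
    Finset.sum_comm
  rw [h2, h3]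
  ring

/-! ### The law of the selected edge and the mean drift -/

/-- The probability that the ordered pair `e` encodes the selected edge. -/
noncomputable def edgeProb (e : Fin n × Fin n) : ℝ := if e.1 < e.2 then N.W e.1 e.2 else 0

theorem W_nonneg {N : GossipModel n} (hcomm : N.CommunityAssumption) (i j : Fin n) :
    0 ≤ N.W i j := by
  simp only [W, Matrix.of_apply]
  split_ifs
  exacts [le_rfl, hcomm.ws_pos.le, hcomm.wd_pos.le]

theorem sum_edgeProb {N : GossipModel n} (hcomm : N.CommunityAssumption) :
    ∑ e, N.edgeProb e = 1 := by
  have h := sum_pairs_lt_eq_half N.W_symm N.W_self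
  rw [sum_sum_W hcomm] at h
  simpa [edgeProb] using h

/-- The law is prescribed only on pairs with `i < j`. These already carry total mass one, so every
other pair has probability zero. -/
theorem IsEdgeSelection.measureReal_eq {N : GossipModel n} (hcomm : N.CommunityAssumption)
    {Ω : Type*} [MeasurableSpace Ω] {P : Measure Ω} [IsProbabilityMeasure P]
    {edge : ℕ → Ω → Fin n × Fin n} (hedge : N.IsEdgeSelection P edge) (t : ℕ) (e : Fin n × Fin n) :
    P.real {ω | edge t ω = e} = N.edgeProb e := by
  have hlt : ∀ e : Fin n × Fin n, e.1 < e.2 → P.real {ω | edge t ω = e} = N.edgeProb e := by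
    rintro ⟨i, j⟩ h
    rw [measureReal_def, hedge.law t i j h, ENNReal.toReal_ofReal (W_nonneg hcomm i j), edgeProb,
      if_pos h]
  have hsum : ∑ e, P.real {ω | edge t ω = e} = 1 :=
    sum_law_eq_one (X := fun _ => edge t) (fun _ => hedge.measurable t) fun _ _ => rfl
  have hle : ∀ e ∈ Finset.univ, N.edgeProb e ≤ P.real {ω | edge t ω = e} := by
    intro e _
    by_cases h : e.1 < e.2
    · exact (hlt e h).ge
    · rw [edgeProb, if_neg h]
      exact measureReal_nonneg
  exact ((Finset.sum_eq_sum_iff_of_le hle).1 ((sum_edgeProb hcomm).trans hsum.symm) e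
    (Finset.mem_univ e)).symm

/-- The mean change of coordinate `l` in one gossip step from `z`. -/
noncomputable def meanDrift (l : Fin n) (z : Fin n → ℝ) : ℝ :=
  ∑ e : Fin n × Fin n, N.edgeProb e * ((N.R e.1 e.2).mulVec z l - z l)

/-- Only edges at `l` move coordinate `l`. Symmetry of `R` in its endpoints turns the sum over `i <
j` into half a double sum, in which each such edge occurs twice. -/
theorem meanDrift_eq {l : Fin n} (hl : l ∉ N.stubborn) (z : Fin n → ℝ) :
    N.meanDrift l z = (1 - N.q) * ∑ j, N.W l j * (z j - z l) := by
  have h := sum_pairs_lt_eq_half (f := fun i j => N.W i j * ((N.R i j).mulVec z l - z l))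
    (fun i j => by rw [N.W_symm, N.R_mulVec_symm]) fun i => by rw [N.W_self, zero_mul]
  have h1 : N.meanDrift l z
      = (∑ i, ∑ j, N.W i j * ((N.R i j).mulVec z l - z l)) / 2 := by
    rw [← h, meanDrift]
    refine Finset.sum_congr rfl fun e _ => ?_
    rw [edgeProb]
    split_ifs <;> simp
  have h2 : ∀ i j, N.W i j * ((N.R i j).mulVec z l - z l)
      = (if l = i then (1 - N.q) * (N.W l j * (z j - z l)) else 0)
        + if l = j then (1 - N.q) * (N.W l i * (z i - z l)) else 0 := by
    intro i j
    rw [R_mulVec_apply]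
    by_cases h1 : l = i <;> by_cases h2 : l = j
    · subst h1; subst h2; simp
    · subst h1; simp [h2, hl]; ring
    · subst h2; simp [h1, hl, N.W_symm i l]; ring
    · simp [h1, h2]
  rw [h1]
  simp_rw [h2, Finset.sum_add_distrib]
  rw [Finset.sum_comm (f := fun i j => if l = i then (1 - N.q) * (N.W l j * (z j - z l)) else 0)]
  simp only [Finset.sum_ite_eq, Finset.mem_univ, if_true]
  rw [← Finset.mul_sum]
  ring

/-! ### The limiting profile -/

/-- The limit of the time averages. -/
noncomputable def profile (i : Fin n) : ℝ := if i ∈ N.stubborn then N.x0 i else N.chi (N.label i)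

theorem sum_reg_profile (k : Label) : ∑ i ∈ N.reg k, N.profile i = N.nR k * N.chi k := by
  rw [Finset.sum_congr rfl (g := fun _ => N.chi k)]
  · simp [nR]
  · intro i hi
    simp only [reg, comm, Finset.mem_filter, Finset.mem_univ, true_and] at hi
    simp [profile, hi.1, hi.2]

theorem sum_stub_profile (k : Label) : ∑ i ∈ N.stub k, N.profile i = N.stubSum k := by
  refine Finset.sum_congr rfl fun i hi => ?_
  simp only [stub, Finset.mem_filter] at hi
  simp [profile, hi.2]

variable {N}

theorem nR_pos (hcomm : N.CommunityAssumption) (k : Label) : 0 < N.nR k :=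
  Nat.cast_pos.2 (hcomm.reg_nonempty k).card_pos

theorem nS_pos (hstub : N.StubbornAssumption) (k : Label) : 0 < N.nS k :=
  Nat.cast_pos.2 (hstub.stub_nonempty k).card_pos

theorem delta_of_label (k : Label) :
    N.delta = N.ws ^ 2 * N.nS k * N.nS k.other
      + N.ws * N.wd * (N.nC k * N.nS k + N.nC k.other * N.nS k.other)
      + N.wd ^ 2 * (N.nC k * N.nC k.other - N.nR k * N.nR k.other) := by
  rw [delta]
  cases k <;> simp only [Label.other]
  ring

theorem delta_pos (hcomm : N.CommunityAssumption) (hstub : N.StubbornAssumption) : 0 < N.delta := by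
  rw [delta, nC_eq, nC_eq]
  have := nR_pos hcomm .one
  have := nR_pos hcomm .two
  have := nS_pos hstub .one
  have := nS_pos hstub .two
  have := hcomm.ws_pos
  have := hcomm.wd_pos
  have h : (N.nS .one + N.nR .one) * (N.nS .two + N.nR .two) - N.nR .one * N.nR .two
      = N.nS .one * N.nS .two + N.nS .one * N.nR .two + N.nR .one * N.nS .two := by ring
  rw [h]
  positivity

/-- Harmonicity at the regular agents of the two communities is a 2×2 linear system with determinant
`δ`; the values `χ` are its solution by Cramer's rule. -/
theorem chi_balance (hcomm : N.CommunityAssumption) (hstub : N.StubbornAssumption) (k : Label) :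
    N.ws * (N.stubSum k - N.nS k * N.chi k)
      + N.wd * (N.stubSum k.other + N.nR k.other * N.chi k.other - N.nC k.other * N.chi k) = 0 := by
  have hδ := (delta_pos hcomm hstub).ne'
  have h1 : N.chi k * N.delta = _ := div_mul_cancel₀ _ hδ
  have h2 : N.chi k.other * N.delta = _ := div_mul_cancel₀ _ hδ
  rw [Label.other_other] at h2
  have hd := N.delta_of_label k
  refine (mul_eq_zero.1 ?_).resolve_right hδ
  rw [N.nC_eq k, N.nC_eq k.other] at *
  linear_combination (-N.ws * N.nS k - N.wd * (N.nS k.other + N.nR k.other)) * h1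
    + N.wd * N.nR k.other * h2 + (N.ws * N.stubSum k + N.wd * N.stubSum k.other) * hd

theorem sum_W_profile (hcomm : N.CommunityAssumption) (hstub : N.StubbornAssumption) {l : Fin n}
    (hl : l ∉ N.stubborn) : ∑ j, N.W l j * (N.profile j - N.profile l) = 0 := by
  rw [N.sum_W_mul l fun j => N.profile j - N.profile l]
  simp only [Finset.sum_sub_distrib, Finset.sum_const, nsmul_eq_mul, sum_comm_eq,
    sum_reg_profile, sum_stub_profile, sub_self, mul_zero, sub_zero]
  have hp : N.profile l = N.chi (N.label l) := by simp [profile, hl]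
  have h := chi_balance hcomm hstub (N.label l)
  have hc := N.nC_eq (N.label l)
  rw [hp]
  simp only [nC] at h hc
  rw [hc]
  linear_combination h

/-- One-sided maximum principle for the killed graph Laplacian. -/
theorem le_div_of_laplacian_ge {w ρ : ℝ} (hw : 0 < w) (hW : ∀ i j, i ≠ j → w ≤ N.W i j)
    (hne : N.stubborn.Nonempty) {u : Fin n → ℝ} (hu : ∀ i ∈ N.stubborn, u i = 0) (hρ : 0 ≤ ρ)
    (h : ∀ l ∉ N.stubborn, -ρ ≤ ∑ j, N.W l j * (u j - u l)) (l : Fin n) : u l ≤ ρ / w := by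
  obtain ⟨m, -, hm⟩ := Finset.exists_max_image Finset.univ u ⟨l, Finset.mem_univ l⟩
  refine (hm l (Finset.mem_univ l)).trans ?_
  by_cases hms : m ∈ N.stubborn
  · rw [hu m hms]; positivity
  obtain ⟨s, hs⟩ := hne
  have hsm : m ≠ s := by rintro rfl; exact hms hs
  have hum : 0 ≤ u m := hu s hs ▸ hm s (Finset.mem_univ s)
  -- At a maximiser every term is nonpositive, so it suffices to keep the stubborn neighbour `s`,
  -- where `u` vanishes.
  have hle : ∑ j, N.W m j * (u j - u m) ≤ N.W m s * (u s - u m) := by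
    rw [← Finset.add_sum_erase _ _ (Finset.mem_univ s)]
    refine add_le_of_nonpos_right (Finset.sum_nonpos fun j _ => ?_)
    have := hm j (Finset.mem_univ j)
    refine mul_nonpos_of_nonneg_of_nonpos ?_ (by linarith)
    by_cases hj : m = j
    · rw [hj, W_self]
    · exact hw.le.trans (hW m j hj)
  have h1 := h m hms
  rw [hu s hs] at hle
  rw [le_div_iff₀ hw]
  nlinarith [hW m s hsm]

theorem abs_le_div_of_abs_laplacian_le {w ρ : ℝ} (hw : 0 < w) (hW : ∀ i j, i ≠ j → w ≤ N.W i j)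
    (hne : N.stubborn.Nonempty) {u : Fin n → ℝ} (hu : ∀ i ∈ N.stubborn, u i = 0) (hρ : 0 ≤ ρ)
    (h : ∀ l ∉ N.stubborn, |∑ j, N.W l j * (u j - u l)| ≤ ρ) (l : Fin n) : |u l| ≤ ρ / w := by
  refine abs_le'.2 ⟨le_div_of_laplacian_ge hw hW hne hu hρ (fun l hl => (abs_le.1 (h l hl)).1) l,
    le_div_of_laplacian_ge (u := fun i => -u i) hw hW hne (fun i hi => by simp [hu i hi]) hρ
      (fun l hl => ?_) l⟩
  have h1 : ∑ j, N.W l j * (-u j - -u l) = -∑ j, N.W l j * (u j - u l) := by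
    rw [← Finset.sum_neg_distrib]
    exact Finset.sum_congr rfl fun j _ => by ring
  rw [h1]
  exact neg_le_neg (abs_le.1 (h l hl)).2

/-! ### Almost sure convergence rate of the time averages -/

theorem _root_.AlgorithmInput.timeAvg_eq (x : ℕ → Fin n → ℝ) (t : ℕ) (i : Fin n) :
    AlgorithmInput.timeAvg x t i = (∑ u ∈ Finset.range (t + 1), x u i) / ((t + 1 : ℕ) : ℝ) := by
  induction t with
  | zero => simp [AlgorithmInput.timeAvg]
  | succ t ih =>
    rw [AlgorithmInput.timeAvg]
    beta_reduce
    rw [ih, Finset.sum_range_succ _ (t + 1)]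
    push_cast
    field_simp
    ring

/-- The centred change of coordinate `l` when edge `e` is selected in state `z`. -/
noncomputable def noise (N : GossipModel n) (l : Fin n) (z : Fin n → ℝ) (e : Fin n × Fin n) : ℝ :=
  (N.R e.1 e.2).mulVec z l - z l - N.meanDrift l z

theorem sum_edgeProb_mul_noise (hcomm : N.CommunityAssumption) (l : Fin n) (z : Fin n → ℝ) :
    ∑ e, N.edgeProb e * N.noise l z e = 0 := by
  simp only [noise, mul_sub _ (_ - _) (N.meanDrift l z), Finset.sum_sub_distrib,
    ← Finset.sum_mul, sum_edgeProb hcomm]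
  rw [one_mul, sub_eq_zero]
  rfl

theorem abs_noise_le (hcomm : N.CommunityAssumption) (l : Fin n) {z : Fin n → ℝ} {B : ℝ}
    (hz : ∀ i, |z i| ≤ B) (e : Fin n × Fin n) : |N.noise l z e| ≤ 4 * B := by
  have h : ∀ e : Fin n × Fin n, |(N.R e.1 e.2).mulVec z l - z l| ≤ 2 * B := fun e => by
    have h1 := N.abs_R_mulVec_le hcomm.q_nonneg hcomm.q_lt_one e.1 e.2 hz l
    have h2 := abs_sub ((N.R e.1 e.2).mulVec z l) (z l)
    linarith [hz l]
  have h0 : ∀ e, 0 ≤ N.edgeProb e := fun e => by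
    rw [edgeProb]; split_ifs; exacts [W_nonneg hcomm _ _, le_rfl]
  have h3 : |N.meanDrift l z| ≤ 2 * B := by
    calc |N.meanDrift l z| ≤ ∑ e : Fin n × Fin n, N.edgeProb e * (2 * B) := by
          refine (Finset.abs_sum_le_sum_abs _ _).trans (Finset.sum_le_sum fun e _ => ?_)
          rw [abs_mul, abs_of_nonneg (h0 e)]
          exact mul_le_mul_of_nonneg_left (h e) (h0 e)
      _ = 2 * B := by rw [← Finset.sum_mul, sum_edgeProb hcomm, one_mul]
  have h4 := abs_sub ((N.R e.1 e.2).mulVec z l - z l) (N.meanDrift l z)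
  rw [noise]
  linarith [h e]

/-- The one-step changes telescope; subtracting the mean drift leaves the accumulated Laplacian. -/
theorem sum_noise_state (s : ℕ → Fin n × Fin n) {l : Fin n} (hl : l ∉ N.stubborn) (T : ℕ) :
    ∑ t ∈ Finset.range T, N.noise l (N.state s t) (s t) = N.state s T l - N.x0 l
      - (1 - N.q) * ∑ t ∈ Finset.range T, ∑ j, N.W l j * (N.state s t j - N.state s t l) := by
  induction T with
  | zero => simp [state]
  | succ T ih =>
    rw [Finset.sum_range_succ, ih, Finset.sum_range_succ, noise, N.meanDrift_eq hl]
    simp only [state]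
    ring

/-- The Laplacian commutes with time averaging and annihilates the profile at regular agents, so
only the boundary terms and the noise remain. -/
theorem laplacian_timeAvg (hcomm : N.CommunityAssumption) (hstub : N.StubbornAssumption)
    (s : ℕ → Fin n × Fin n) {l : Fin n} (hl : l ∉ N.stubborn) (t : ℕ) :
    ∑ j, N.W l j * ((AlgorithmInput.timeAvg (N.state s) t j - N.profile j)
        - (AlgorithmInput.timeAvg (N.state s) t l - N.profile l))
      = (N.state s (t + 1) l - N.x0 l
          - ∑ u ∈ Finset.range (t + 1), N.noise l (N.state s u) (s u))
        / ((1 - N.q) * ((t + 1 : ℕ) : ℝ)) := by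
  have hq : 1 - N.q ≠ 0 := (sub_pos.2 hcomm.q_lt_one).ne'
  have hT : ((t + 1 : ℕ) : ℝ) ≠ 0 := by positivity
  have h1 : ∑ j, N.W l j * ((AlgorithmInput.timeAvg (N.state s) t j - N.profile j)
        - (AlgorithmInput.timeAvg (N.state s) t l - N.profile l))
      = ∑ j, N.W l j * (AlgorithmInput.timeAvg (N.state s) t j
          - AlgorithmInput.timeAvg (N.state s) t l)
        - ∑ j, N.W l j * (N.profile j - N.profile l) := by
    rw [← Finset.sum_sub_distrib]
    exact Finset.sum_congr rfl fun j _ => by ring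
  rw [h1, sum_W_profile hcomm hstub hl, sub_zero, sum_noise_state s hl, Finset.sum_comm,
    eq_div_iff (mul_ne_zero hq hT), Finset.sum_mul]
  rw [sub_sub_cancel, Finset.mul_sum]
  refine Finset.sum_congr rfl fun j _ => ?_
  rw [AlgorithmInput.timeAvg_eq, AlgorithmInput.timeAvg_eq, ← Finset.mul_sum,
    Finset.sum_sub_distrib]
  field_simp

theorem ae_isBigO_timeAvg_sub_profile (hcomm : N.CommunityAssumption)
    (hstub : N.StubbornAssumption) {Ω : Type*} [MeasurableSpace Ω] {P : Measure Ω}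
    [IsProbabilityMeasure P] {edge : ℕ → Ω → Fin n × Fin n} (hedge : N.IsEdgeSelection P edge)
    {d : ℝ} (hd0 : 0 ≤ d) (hd : d < 1 / 2) :
    ∀ᵐ ω ∂P, ∀ l, (fun t : ℕ =>
      AlgorithmInput.timeAvg (N.state fun t => edge t ω) t l - N.profile l)
        =O[atTop] fun t : ℕ => (t : ℝ) ^ (-d) := by
  set B : ℝ := ∑ i, |N.x0 i|
  have hB0 : 0 ≤ B := Finset.sum_nonneg fun i _ => abs_nonneg _
  have hB := N.abs_state_le hcomm.q_nonneg hcomm.q_lt_one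
  -- The slack `1/2 - d` is positive and makes the exponent `1 - d`, so division by `t + 1` leaves
  -- the rate `-d`.
  have hconc : ∀ᵐ ω ∂P, ∀ l, ∀ᶠ T : ℕ in atTop,
      |∑ t ∈ Finset.range T, N.noise l (N.state (fun i => edge i ω) t) (edge t ω)|
        ≤ (T : ℝ) ^ (1 / 2 + (1 / 2 - d)) := by
    rw [ae_all_iff]
    intro l
    exact ae_eventually_abs_sum_increments_le hedge.measurable hedge.indep
      (hedge.measureReal_eq hcomm) (D := fun t s e => N.noise l (N.state s t) e)
      (fun t s s' e h => by rw [N.state_congr h])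
      -- The `+ 1` keeps the bound positive even if all initial states vanish.
      (fun t s => sum_edgeProb_mul_noise hcomm l _) (c := 4 * B + 1) (by positivity)
      (fun t s e => (abs_noise_le hcomm l (hB s t) e).trans (by linarith)) (by linarith)
  set w := min N.ws N.wd
  have hw : 0 < w := lt_min hcomm.ws_pos hcomm.wd_pos
  have hW : ∀ i j, i ≠ j → w ≤ N.W i j := by
    intro i j hij
    simp only [W, Matrix.of_apply, if_neg hij]
    split_ifs
    exacts [min_le_left _ _, min_le_right _ _]
  have hne : N.stubborn.Nonempty := by
    obtain ⟨i, hi⟩ := hstub.stub_nonempty .one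
    exact ⟨i, (Finset.mem_filter.1 hi).2⟩
  have hq : 0 < 1 - N.q := sub_pos.2 hcomm.q_lt_one
  filter_upwards [hconc] with ω hω l
  set s : ℕ → Fin n × Fin n := fun t => edge t ω
  refine IsBigO.of_bound ((2 * B + 1) / (1 - N.q) / w) ?_
  filter_upwards [(tendsto_add_atTop_nat 1).eventually (eventually_all.2 hω),
    eventually_gt_atTop 0] with t ht ht0
  have htp : (0 : ℝ) < t := by exact_mod_cast ht0
  have hT : (0 : ℝ) < ((t + 1 : ℕ) : ℝ) := by positivity
  have hTt : ((t + 1 : ℕ) : ℝ) ^ (-d) ≤ (t : ℝ) ^ (-d) :=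
    Real.rpow_le_rpow_of_nonpos htp (by push_cast; linarith) (by linarith)
  have hT1 : (1 : ℝ) ≤ ((t + 1 : ℕ) : ℝ) ^ (1 - d) :=
    Real.one_le_rpow (by push_cast; linarith) (by linarith)
  have hTd : ((t + 1 : ℕ) : ℝ) ^ (1 - d) = ((t + 1 : ℕ) : ℝ) * ((t + 1 : ℕ) : ℝ) ^ (-d) := by
    rw [sub_eq_add_neg, Real.rpow_add hT, Real.rpow_one]
  have key := abs_le_div_of_abs_laplacian_le hw hW hne
    (u := fun i => AlgorithmInput.timeAvg (N.state s) t i - N.profile i)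
    (ρ := (2 * B + 1) / (1 - N.q) * (t : ℝ) ^ (-d)) (fun i hi => ?_) (by positivity)
    (fun i hi => ?_) l
  · rw [Real.norm_eq_abs, Real.norm_of_nonneg (Real.rpow_pos_of_pos htp _).le]
    exact key.trans (le_of_eq (by ring))
  · rw [AlgorithmInput.timeAvg_eq]
    simp only [N.state_of_mem_stubborn s _ hi, profile, hi, if_true, Finset.sum_const,
      Finset.card_range, nsmul_eq_mul]
    field_simp
    ring
  · rw [laplacian_timeAvg hcomm hstub s hi, abs_div, abs_of_pos (mul_pos hq hT)]
    have h1 := hB s (t + 1) i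
    have h2 := hB s 0 i
    have h3 := ht i
    rw [show (1 : ℝ) / 2 + (1 / 2 - d) = 1 - d by ring] at h3
    have h4 := abs_sub (N.state s (t + 1) i - N.x0 i)
      (∑ u ∈ Finset.range (t + 1), N.noise i (N.state s u) (s u))
    have h5 := abs_sub (N.state s (t + 1) i) (N.x0 i)
    have h6 : |N.state s (t + 1) i - N.x0 i
        - ∑ u ∈ Finset.range (t + 1), N.noise i (N.state s u) (s u)|
        ≤ (2 * B + 1) * ((t + 1 : ℕ) : ℝ) ^ (1 - d) := by
      have h7 : 2 * B * 1 ≤ 2 * B * ((t + 1 : ℕ) : ℝ) ^ (1 - d) := by gcongr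
      have h8 : |N.x0 i| ≤ B := h2
      linarith
    rw [div_le_iff₀ (mul_pos hq hT)]
    refine h6.trans ?_
    rw [hTd]
    calc _ ≤ (2 * B + 1) * (((t + 1 : ℕ) : ℝ) * (t : ℝ) ^ (-d)) := by gcongr
      _ = _ := by field_simp

end GossipModel

namespace GossipModel

variable {n : ℕ} {N : GossipModel n}

/-! ### Community recovery -/

theorem sum_compl_stubborn_eq (k : Label) (f : Fin n → ℝ) :
    ∑ i ∈ N.stubbornᶜ, f i = ∑ i ∈ N.reg k, f i + ∑ i ∈ N.reg k.other, f i := by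
  rw [← Finset.sum_filter_add_sum_filter_not N.stubbornᶜ (fun i => N.label i = k) f]
  congr 1
  · refine Finset.sum_congr ?_ fun _ _ => rfl
    ext i
    simp [reg, comm, and_comm]
  · refine Finset.sum_congr ?_ fun _ _ => rfl
    ext i
    simp [reg, comm, Label.ne_iff_eq_other, and_comm]

theorem card_compl_stubborn (k : Label) :
    (N.stubbornᶜ.card : ℝ) = N.nR k + N.nR k.other := by
  simpa [nR] using N.sum_compl_stubborn_eq k fun _ => 1

/-- The label used by the algorithm for community `j` when `k` is the community with the larger
limiting mean. -/
def outputLabel (k j : Label) : Label := if j = k then .one else .two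

theorem outputLabel_eq_one_iff {k j : Label} : outputLabel k j = .one ↔ j = k := by
  simp [outputLabel]

theorem outputLabel_eq_two_iff {k j : Label} : outputLabel k j = .two ↔ j = k.other := by
  rw [← Label.ne_iff_eq_other]
  simp [outputLabel]

section Recovery

variable (hcomm : N.CommunityAssumption) (I : AlgorithmInput n) (hI : I.stubborn = N.stubborn)
  {x : ℕ → Fin n → ℝ} {k : Label} (hk : N.chi k.other < N.chi k)

include hcomm hI hk in
-- The limiting threshold `m` is a convex combination of the two values `χ` with positive weights,
-- hence strictly separates them.
theorem eventually_regLabel_eq (hx : ∀ l, Tendsto (fun t => AlgorithmInput.timeAvg x t l) atTop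
      (nhds (N.profile l))) :
    ∀ᶠ t in atTop, ∀ i ∉ N.stubborn, I.regLabel x t i = outputLabel k (N.label i) := by
  set m := 1 / (N.stubbornᶜ.card : ℝ) * ∑ i ∈ N.stubbornᶜ, N.profile i
  have hmean : Tendsto (fun t => I.meanAvg x t) atTop (nhds m) := by
    simp only [AlgorithmInput.meanAvg, hI]
    exact (tendsto_finsetSum _ fun i _ => hx i).const_mul _
  have hm : m = (N.nR k * N.chi k + N.nR k.other * N.chi k.other) / (N.nR k + N.nR k.other) := by
    simp only [m]
    rw [card_compl_stubborn k, sum_compl_stubborn_eq k, sum_reg_profile, sum_reg_profile]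
    ring
  have h1 := nR_pos hcomm k
  have h2 := nR_pos hcomm k.other
  have hm1 : m < N.chi k := by
    rw [hm, div_lt_iff₀ (by positivity)]
    nlinarith
  have hm2 : N.chi k.other < m := by
    rw [hm, lt_div_iff₀ (by positivity)]
    nlinarith
  rw [eventually_all]
  intro i
  by_cases hi : i ∈ N.stubborn
  · exact Eventually.of_forall fun t h => absurd hi h
  have hp : N.profile i = N.chi (N.label i) := by simp [profile, hi]
  have hxi := hx i
  rw [hp] at hxi
  by_cases hl : N.label i = k
  · rw [hl] at hxi
    filter_upwards [hmean.eventually_lt hxi hm1] with t ht _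
    simp [AlgorithmInput.regLabel, outputLabel, hl, ht]
  · rw [Label.ne_iff_eq_other.1 hl] at hxi
    filter_upwards [hxi.eventually_lt hmean hm2] with t ht _
    simp [AlgorithmInput.regLabel, outputLabel, hl, ht.le]

include hcomm hI hk in
theorem eventually_labelHat_eq
    (hrep : ∀ i ∈ N.stubborn, I.rep i ∉ N.stubborn ∧ N.label (I.rep i) = N.label i)
    (hx : ∀ l, Tendsto (fun t => AlgorithmInput.timeAvg x t l) atTop (nhds (N.profile l))) :
    ∀ᶠ t in atTop, ∀ i, I.labelHat x t i = outputLabel k (N.label i) := by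
  filter_upwards [eventually_regLabel_eq hcomm I hI hk hx, eventually_gt_atTop 0] with t ht ht0 i
  -- Time `0` is excluded because the initial labels are arbitrary.
  obtain ⟨t, rfl⟩ := Nat.exists_eq_succ_of_ne_zero ht0.ne'
  simp only [AlgorithmInput.labelHat, hI]
  split_ifs with hi
  · rw [ht _ (hrep i hi).1, (hrep i hi).2]
  · exact ht i hi

variable {t : ℕ} (hlab : ∀ i, I.labelHat x t i = outputLabel k (N.label i))

include hlab in
theorem nHat_one_eq : I.nHat x .one t = N.nC k := by
  simp only [AlgorithmInput.nHat, hlab, outputLabel_eq_one_iff]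
  rfl

include hlab in
theorem nHat_two_eq : I.nHat x .two t = N.nC k.other := by
  simp only [AlgorithmInput.nHat, hlab, outputLabel_eq_two_iff]
  rfl

include hlab hI in
theorem regHat_one_eq : I.regHat x .one t = N.reg k := by
  ext i
  simp [AlgorithmInput.regHat, reg, comm, hlab, hI, outputLabel_eq_one_iff, and_comm]

include hlab hI in
theorem regHat_two_eq : I.regHat x .two t = N.reg k.other := by
  ext i
  simp [AlgorithmInput.regHat, reg, comm, hlab, hI, outputLabel_eq_two_iff, and_comm]

include hlab hI in
theorem stubHat_one_eq : I.stubHat x .one t = N.stub k := by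
  ext i
  simp [AlgorithmInput.stubHat, stub, comm, hlab, hI, outputLabel_eq_one_iff, and_comm]

include hlab hI in
theorem stubHat_two_eq : I.stubHat x .two t = N.stub k.other := by
  ext i
  simp [AlgorithmInput.stubHat, stub, comm, hlab, hI, outputLabel_eq_two_iff, and_comm]

include hlab in
theorem sameHat_eq : I.sameHat x t
    = N.nC k ^ 2 + N.nC k.other ^ 2 - N.nC k - N.nC k.other := by
  rw [AlgorithmInput.sameHat, nHat_one_eq I hlab, nHat_two_eq I hlab]

/-! ### The limits of `h₁`, `h₂` and `g` -/

/-- The limit of `h₁` when `k` is the community with the larger limiting mean. -/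
noncomputable def h1Lim (N : GossipModel n) (k : Label) : ℝ := N.nS k * N.chi k - N.stubSum k

/-- The limit of `h₂` when `k` is the community with the larger limiting mean. -/
noncomputable def h2Lim (N : GossipModel n) (k : Label) : ℝ :=
  N.nC k.other * N.chi k - N.nR k.other * N.chi k.other - N.stubSum k.other

/-- The deviation of the sum of the time averages over the regular agents of community `k`. -/
noncomputable def regDev (N : GossipModel n) (x : ℕ → Fin n → ℝ) (k : Label) (t : ℕ) : ℝ :=
  ∑ i ∈ N.reg k, (AlgorithmInput.timeAvg x t i - N.profile i)

theorem sum_reg_timeAvg (j : Label) : ∑ i ∈ N.reg j, AlgorithmInput.timeAvg x t i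
    = N.nR j * N.chi j + N.regDev x j t := by
  rw [regDev, Finset.sum_sub_distrib, sum_reg_profile]
  ring

include hcomm hlab hI in
theorem h1_eq (hx0 : x 0 = N.x0) :
    I.h1 x t = N.h1Lim k + N.nS k / N.nR k * N.regDev x k t := by
  have h := (nR_pos hcomm k).ne'
  rw [AlgorithmInput.h1, regHat_one_eq I hI hlab, stubHat_one_eq I hI hlab, hx0, sum_reg_timeAvg,
    h1Lim]
  change N.nS k / N.nR k * _ - N.stubSum k = _
  field_simp
  ring

include hcomm hlab hI in
theorem h2_eq (hx0 : x 0 = N.x0) :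
    I.h2 x t = N.h2Lim k + (N.nC k.other / N.nR k * N.regDev x k t - N.regDev x k.other t) := by
  have h := (nR_pos hcomm k).ne'
  rw [AlgorithmInput.h2, regHat_one_eq I hI hlab, regHat_two_eq I hI hlab,
    stubHat_two_eq I hI hlab, nHat_two_eq I hlab, hx0, sum_reg_timeAvg, sum_reg_timeAvg, h2Lim]
  change N.nC k.other / N.nR k * _ - _ - N.stubSum k.other = _
  field_simp
  ring

end Recovery

theorem nC_pos (hcomm : N.CommunityAssumption) (k : Label) : 0 < N.nC k := by
  rw [nC_eq, nS]
  have := nR_pos hcomm k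
  positivity

/-- This identity makes `w_s` the zero of `w ↦ η * w + h2Lim / (n₁ n₂)`, the limiting update
direction. -/
theorem h2Lim_eq (hcomm : N.CommunityAssumption) (hstub : N.StubbornAssumption) (k : Label) :
    N.h2Lim k = -(N.ws * N.eta k * (N.nC k * N.nC k.other)) := by
  have hδ := (delta_pos hcomm hstub).ne'
  have h1 := (nC_pos hcomm .one).ne'
  have h2 := (nC_pos hcomm .two).ne'
  have hη : N.eta k * (N.nC k * N.nC k.other) * N.delta = (N.ws * N.nC k.other + N.wd * N.nC k)
      * (N.nS k * N.stubSum k.other - N.nS k.other * N.stubSum k) := by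
    rw [eta]
    cases k <;> simp only [Label.other] <;> field_simp
  have hc1 : N.chi k * N.delta = _ := div_mul_cancel₀ _ hδ
  have hc2 : N.chi k.other * N.delta = _ := div_mul_cancel₀ _ hδ
  rw [Label.other_other] at hc2
  have hd := N.delta_of_label k
  refine mul_right_cancel₀ hδ ?_
  rw [h2Lim]
  rw [N.nC_eq k, N.nC_eq k.other] at *
  linear_combination (N.nS k.other + N.nR k.other) * hc1 - N.nR k.other * hc2
    - N.stubSum k.other * hd + N.ws * hη

theorem h1Lim_h2Lim_balance (hcomm : N.CommunityAssumption) (hstub : N.StubbornAssumption)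
    (k : Label) : N.ws * N.h1Lim k + N.wd * N.h2Lim k = 0 := by
  have h := chi_balance hcomm hstub k
  rw [h1Lim, h2Lim]
  linear_combination -h

/-- After multiplication by `w_s`, the balance relation replaces `w_s * h1Lim` by `-w_d * h2Lim`.
The normalisation of the edge probabilities then collapses the left side to `-h2Lim / (n₁ n₂)`,
which is `w_s * η`. -/
theorem eta_eq (hcomm : N.CommunityAssumption) (hstub : N.StubbornAssumption) (k : Label) :
    N.h1Lim k - (N.nC k ^ 2 + N.nC k.other ^ 2 - N.nC k - N.nC k.other)
      / (2 * N.nC k * N.nC k.other) * N.h2Lim k = N.eta k := by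
  have h1 := (nC_pos hcomm k).ne'
  have h2 := (nC_pos hcomm k.other).ne'
  have hb := h1Lim_h2Lim_balance hcomm hstub k
  have ht := total_of_label hcomm k
  have hη := h2Lim_eq hcomm hstub k
  refine mul_left_cancel₀ hcomm.ws_pos.ne' ?_
  field_simp
  linear_combination 2 * N.nC k * N.nC k.other * hb - N.h2Lim k * ht - 2 * hη

/-! ### Convergence of the estimates -/

/-- The factor `sgn g` turns the gain into `a|g|`, contracting whatever the sign of `η`. The forcing
is the update direction evaluated at `w_s`; its limit vanishes, so it inherits the rate of the
deviations. -/
theorem isBigO_wsHat_sub (hcomm : N.CommunityAssumption) (hstub : N.StubbornAssumption)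
    (I : AlgorithmInput n) (hI : I.stubborn = N.stubborn)
    {x : ℕ → Fin n → ℝ} (hx0 : x 0 = N.x0) {k : Label}
    (hlab : ∀ᶠ t in atTop, ∀ i, I.labelHat x t i = outputLabel k (N.label i)) {d : ℝ}
    (hd0 : 0 < d) (hd1 : d ≤ 1) (hda : d < I.a * |N.eta k|)
    (hx : ∀ l, (fun t : ℕ => AlgorithmInput.timeAvg x t l - N.profile l)
      =O[atTop] fun t : ℕ => (t : ℝ) ^ (-d)) :
    (fun t => I.wsHat x t - N.ws) =O[atTop] fun t : ℕ => (t : ℝ) ^ (-d) := by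
  have hdev : ∀ j, N.regDev x j =O[atTop] fun t : ℕ => (t : ℝ) ^ (-d) := fun j =>
    IsBigO.fun_sum fun i _ => hx i
  set m := N.nC k ^ 2 + N.nC k.other ^ 2 - N.nC k - N.nC k.other
  set p1 : ℕ → ℝ := fun t => N.nS k / N.nR k * N.regDev x k t
  set p2 : ℕ → ℝ := fun t => N.nC k.other / N.nR k * N.regDev x k t - N.regDev x k.other t
  set pg : ℕ → ℝ := fun t => p1 t - m / (2 * N.nC k * N.nC k.other) * p2 t
  have hp1 : p1 =O[atTop] fun t : ℕ => (t : ℝ) ^ (-d) := (hdev k).const_mul_left _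
  have hp2 : p2 =O[atTop] fun t : ℕ => (t : ℝ) ^ (-d) :=
    ((hdev k).const_mul_left _).sub (hdev k.other)
  have hpg : pg =O[atTop] fun t : ℕ => (t : ℝ) ^ (-d) := hp1.sub (hp2.const_mul_left _)
  have hg : ∀ᶠ t in atTop, I.g x t = N.eta k + pg t := by
    filter_upwards [hlab] with t ht
    rw [AlgorithmInput.g, h1_eq hcomm I hI ht hx0, h2_eq hcomm I hI ht hx0, sameHat_eq I ht,
      nHat_one_eq I ht, nHat_two_eq I ht, ← eta_eq hcomm hstub k]
    simp only [pg, p1, p2, m]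
    ring
  have hzero : Tendsto (fun t : ℕ => (t : ℝ) ^ (-d)) atTop (nhds 0) :=
    (tendsto_rpow_neg_atTop hd0).comp tendsto_natCast_atTop_atTop
  have hglim : Tendsto (fun t => I.g x t) atTop (nhds (N.eta k)) := by
    have h := (hpg.trans_tendsto hzero).const_add (N.eta k)
    rw [add_zero] at h
    exact h.congr' (hg.mono fun t ht => ht.symm)
  refine isBigO_rpow_neg_of_recursion (c := fun t => I.a * |I.g x t|)
    (r := fun t => -(I.a * Real.sign (I.g x t)
      * (I.g x t * N.ws + I.h2 x t / (I.nHat x .one t * I.nHat x .two t))))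
    hd0.le hd1 hda (hglim.abs.const_mul _) ?_ fun t => ?_
  · have hq : (fun t => I.a * (pg t * N.ws + p2 t / (N.nC k * N.nC k.other)))
        =O[atTop] fun t : ℕ => (t : ℝ) ^ (-d) := by
      refine IsBigO.const_mul_left (IsBigO.add ?_ ?_) _
      · simpa [mul_comm] using hpg.const_mul_left N.ws
      · simpa [div_eq_inv_mul] using hp2.const_mul_left (N.nC k * N.nC k.other)⁻¹
    refine IsBigO.trans (IsBigO.of_bound 1 ?_) hq
    filter_upwards [hlab, hg] with t ht hgt
    have hn1 := (nC_pos hcomm k).ne'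
    have hn2 := (nC_pos hcomm k.other).ne'
    -- The limiting parts `η * w_s` and `h2Lim / (n₁ n₂)` cancel exactly.
    have h1 : I.g x t * N.ws + I.h2 x t / (I.nHat x .one t * I.nHat x .two t)
        = pg t * N.ws + p2 t / (N.nC k * N.nC k.other) := by
      rw [hgt, h2_eq hcomm I hI ht hx0, nHat_one_eq I ht, nHat_two_eq I ht,
        h2Lim_eq hcomm hstub k]
      simp only [p2]
      field_simp
      ring
    rw [h1, norm_neg, one_mul, norm_mul, norm_mul, norm_mul]
    have hs : ‖Real.sign (I.g x t)‖ ≤ 1 := by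
      rcases Real.sign_apply_eq (I.g x t) with h | h | h <;> simp [h]
    calc _ ≤ ‖I.a‖ * 1 * ‖pg t * N.ws + p2 t / (N.nC k * N.nC k.other)‖ := by gcongr
      _ = _ := by rw [mul_one]
  · have hs : Real.sign (I.g x (t + 1)) * I.g x (t + 1) = |I.g x (t + 1)| := by
      rcases lt_trichotomy (I.g x (t + 1)) 0 with h | h | h
      · rw [Real.sign_of_neg h, abs_of_neg h]; ring
      · rw [h]; simp
      · rw [Real.sign_of_pos h, abs_of_pos h]; ring
    simp only [AlgorithmInput.wsHat]
    rw [← hs]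
    push_cast
    ring

/-- With correct labels, `ŵ_d` is the same affine function of `ŵ_s` as `w_d` is of `w_s` by the
normalisation. -/
theorem eventually_wdHat_sub_eq (hcomm : N.CommunityAssumption) (I : AlgorithmInput n)
    {x : ℕ → Fin n → ℝ} {k : Label}
    (hlab : ∀ᶠ t in atTop, ∀ i, I.labelHat x t i = outputLabel k (N.label i)) :
    ∀ᶠ t in atTop, I.wdHat x t - N.wd
      = -((N.nC k ^ 2 + N.nC k.other ^ 2 - N.nC k - N.nC k.other) / (2 * N.nC k * N.nC k.other))
        * (I.wsHat x t - N.ws) := by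
  filter_upwards [hlab, eventually_gt_atTop 0] with t ht ht0
  obtain ⟨t, rfl⟩ := Nat.exists_eq_succ_of_ne_zero ht0.ne'
  have hn1 := (nC_pos hcomm k).ne'
  have hn2 := (nC_pos hcomm k.other).ne'
  have h := total_of_label hcomm k
  simp only [Nat.succ_eq_add_one] at ht ⊢
  rw [AlgorithmInput.wdHat, sameHat_eq I ht, nHat_one_eq I ht, nHat_two_eq I ht]
  field_simp
  linear_combination -h

end GossipModel

theorem theorem4 {n : ℕ} (N : GossipModel n)
    (hcomm : N.CommunityAssumption) (hstub : N.StubbornAssumption)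
    -- the gossip process, driven by an i.i.d. selection of edges
    {Ω : Type*} [MeasurableSpace Ω] (P : Measure Ω) [IsProbabilityMeasure P]
    (edge : ℕ → Ω → Fin n × Fin n) (hedge : N.IsEdgeSelection P edge)
    -- every stubborn agent comes with a known regular agent of the same community
    (rep : Fin n → Fin n)
    (hrep : ∀ i ∈ N.stubborn, rep i ∉ N.stubborn ∧ N.label (rep i) = N.label i)
    -- step-size parameter and (random, otherwise arbitrary) initial estimates
    (a : ℝ) (ha : 0 < a) (label0 : Ω → Fin n → Label) (ws0 wd0 : Ω → ℝ)
    -- `k` is the community whose regular agents have the larger limiting mean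
    (k : Label) (hk : N.chi k.other < N.chi k)
    (d₀ : ℝ) (hd₀ : d₀ ∈ Set.Ico 0 (min (1 / 2) (a * |N.eta k|))) :
    ∀ᵐ ω ∂P,
      let x : ℕ → Fin n → ℝ := N.state fun t => edge t ω
      let I : AlgorithmInput n := ⟨N.stubborn, rep, a, label0 ω, ws0 ω, wd0 ω⟩
      (fun t : ℕ => (I.wsHat x t - N.ws, I.wdHat x t - N.wd))
        =o[atTop] fun t : ℕ => (t : ℝ) ^ (-d₀) := by
  -- Room above `d₀` upgrades `O(t ^ (-d))` to `o(t ^ (-d₀))`, and gives a positive rate even when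
  -- `d₀ = 0`.
  obtain ⟨d, hd₀d, hd⟩ := exists_between hd₀.2
  have hd0 : 0 < d := hd₀.1.trans_lt hd₀d
  have hdhalf : d < 1 / 2 := hd.trans_le (min_le_left _ _)
  have hzero : Tendsto (fun t : ℕ => (t : ℝ) ^ (-d)) atTop (nhds 0) :=
    (tendsto_rpow_neg_atTop hd0).comp tendsto_natCast_atTop_atTop
  have hlittle : (fun t : ℕ => (t : ℝ) ^ (-d)) =o[atTop] fun t : ℕ => (t : ℝ) ^ (-d₀) := by
    have h1 : Tendsto (fun t : ℕ => (t : ℝ) ^ (-(d - d₀))) atTop (nhds 0) :=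
      (tendsto_rpow_neg_atTop (sub_pos.2 hd₀d)).comp tendsto_natCast_atTop_atTop
    have h2 := ((isLittleO_one_iff ℝ).2 h1).mul_isBigO
      (isBigO_refl (fun t : ℕ => (t : ℝ) ^ (-d₀)) atTop)
    simp only [one_mul] at h2
    refine h2.congr' ?_ EventuallyEq.rfl
    filter_upwards [eventually_gt_atTop 0] with t ht
    rw [← Real.rpow_add (by exact_mod_cast ht)]
    congr 1
    ring
  filter_upwards [GossipModel.ae_isBigO_timeAvg_sub_profile hcomm hstub hedge hd0.le hdhalf]
    with ω hω
  intro x I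
  have htend : ∀ l, Tendsto (fun t => AlgorithmInput.timeAvg x t l) atTop
      (nhds (N.profile l)) := fun l =>
    tendsto_sub_nhds_zero_iff.1 ((hω l).trans_tendsto hzero)
  have hlab := GossipModel.eventually_labelHat_eq hcomm I rfl hk hrep htend
  have hws : (fun t => I.wsHat x t - N.ws) =o[atTop] fun t : ℕ => (t : ℝ) ^ (-d₀) :=
    (GossipModel.isBigO_wsHat_sub hcomm hstub I rfl rfl hlab hd0 (by linarith)
      (hd.trans_le (min_le_right _ _)) hω).trans_isLittleO hlittle
  refine hws.prod_left ?_
  exact (hws.const_mul_left _).congr'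
    ((GossipModel.eventually_wdHat_sub_eq hcomm I hlab).mono fun t ht => ht.symm) EventuallyEq.rfl
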